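/- Let $R$ be a prime ring (associative, not necessarily with unity) with center $Z(R)$, that is, for $a,b\in R$, $aRb=0$ implies $a=0$ or $b=0$. Let $C$ be the extended centroid of $R$, i.e. the center of the Martindale symmetric ring of quotients $Q_s(R)\supseteq R$. For subsets $A,B$ of a ring, $AB$ (resp. $[A,B]$) denotes the additive subgroup generated by all products $ab$ (resp. all commutators $ab-ba$) with $a\in A$, $b\in B$; in particular $LC$ is the additive subgroup of $Q_s(R)$ generated by all $\ell c$ with $\ell\in L$, $c\in C$, and $Ca+C=\{ca+d : c,d\in C\}\subseteq Q_s(R)$. A Lie ideal of $R$ is an additive subgroup $L$ with $[L,R]\subseteq L$; it is noncentral if $L\not\subseteq Z(R)$. Let $m,n\ge 1$ and let $K_1,\ldots,K_m,L_1,\ldots,L_n$ be noncentral Lie ideals of $R$. Then $[K_1K_2\cdots K_m,\;L_1L_2\cdots L_n]=0$ if and only if, for all $1\le j\le m$, all $1\le k\le n$ and every element $a\in K_1\setminus Z(R)$, one has $$K_1C=K_jC=L_kC=Ca+C.$$ -/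

import Mathlib

open scoped Pointwise

/-- A nonzero associative ring, not necessarily with unity, is *prime* if `a R b = 0` implies
`a = 0` or `b = 0`. -/
class IsPrimeRing (R : Type*) [NonUnitalRing R] : Prop extends Nontrivial R where
  eq_zero_or_eq_zero : ∀ a b : R, (∀ r : R, a * r * b = 0) → a = 0 ∨ b = 0

namespace Martindale

section Ideals

variable {R : Type*} [NonUnitalRing R]

/-- The product `I J` of two ideals: all finite sums of elements `x * y`, `x ∈ I`, `y ∈ J`. -/
def idealMul (I J : TwoSidedIdeal R) : TwoSidedIdeal R :=
  TwoSidedIdeal.mk' (AddSubgroup.closure {z : R | ∃ x ∈ I, ∃ y ∈ J, z = x * y} : Set R)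
    (zero_mem _) (fun hx hy => add_mem hx hy) (fun hx => neg_mem hx)
    (by
      intro x y hy
      change x * y ∈ AddSubgroup.closure _
      refine AddSubgroup.closure_induction (p := fun y _ => x * y ∈ AddSubgroup.closure _)
        ?_ ?_ ?_ ?_ hy
      · rintro _ ⟨u, hu, v, hv, rfl⟩
        exact AddSubgroup.subset_closure
          ⟨x * u, I.mul_mem_left _ _ hu, v, hv, (mul_assoc _ _ _).symm⟩
      · simp
      · intro a b _ _ ha hb
        rw [mul_add]
        exact add_mem ha hb
      · intro a _ ha
        rw [mul_neg]
        exact neg_mem ha)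
    (by
      intro y x hy
      change y * x ∈ AddSubgroup.closure _
      refine AddSubgroup.closure_induction (p := fun y _ => y * x ∈ AddSubgroup.closure _)
        ?_ ?_ ?_ ?_ hy
      · rintro _ ⟨u, hu, v, hv, rfl⟩
        exact AddSubgroup.subset_closure
          ⟨u, hu, v * x, J.mul_mem_right _ _ hv, mul_assoc _ _ _⟩
      · simp
      · intro a b _ _ ha hb
        rw [add_mul]
        exact add_mem ha hb
      · intro a _ ha
        rw [neg_mul]
        exact neg_mem ha)

theorem mem_idealMul {I J : TwoSidedIdeal R} {z : R} :
    z ∈ idealMul I J ↔ z ∈ AddSubgroup.closure {z : R | ∃ x ∈ I, ∃ y ∈ J, z = x * y} := by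
  rw [idealMul, TwoSidedIdeal.mem_mk']
  rfl

theorem mul_mem_idealMul {I J : TwoSidedIdeal R} {x y : R} (hx : x ∈ I) (hy : y ∈ J) :
    x * y ∈ idealMul I J :=
  mem_idealMul.2 (AddSubgroup.subset_closure ⟨x, hx, y, hy, rfl⟩)

theorem idealMul_induction {I J : TwoSidedIdeal R} {p : R → Prop}
    (mul : ∀ x ∈ I, ∀ y ∈ J, p (x * y)) (zero : p 0)
    (add : ∀ x ∈ idealMul I J, ∀ y ∈ idealMul I J, p x → p y → p (x + y))
    (neg : ∀ x ∈ idealMul I J, p x → p (-x))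
    {z : R} (hz : z ∈ idealMul I J) : p z := by
  refine AddSubgroup.closure_induction (p := fun z _ => p z) ?_ zero ?_ ?_ (mem_idealMul.1 hz)
  · rintro _ ⟨u, hu, v, hv, rfl⟩
    exact mul u hu v hv
  · intro a b ha hb
    exact add a (mem_idealMul.2 ha) b (mem_idealMul.2 hb)
  · intro a ha
    exact neg a (mem_idealMul.2 ha)

theorem idealMul_le_left (I J : TwoSidedIdeal R) {z : R} (hz : z ∈ idealMul I J) : z ∈ I :=
  idealMul_induction (p := fun z => z ∈ I) (fun _ hx _ _ => I.mul_mem_right _ _ hx) I.zero_mem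
    (fun _ _ _ _ h h' => I.add_mem h h') (fun _ _ h => I.neg_mem h) hz

theorem idealMul_le_right (I J : TwoSidedIdeal R) {z : R} (hz : z ∈ idealMul I J) : z ∈ J :=
  idealMul_induction (p := fun z => z ∈ J) (fun _ _ _ hy => J.mul_mem_left _ _ hy) J.zero_mem
    (fun _ _ _ _ h h' => J.add_mem h h') (fun _ _ h => J.neg_mem h) hz

theorem idealMul_mono {I I' J J' : TwoSidedIdeal R} (hI : ∀ x ∈ I, x ∈ I')
    (hJ : ∀ x ∈ J, x ∈ J') {z : R} (hz : z ∈ idealMul I J) : z ∈ idealMul I' J' :=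
  idealMul_induction (p := fun z => z ∈ idealMul I' J')
    (fun x hx y hy => mul_mem_idealMul (hI x hx) (hJ y hy)) (TwoSidedIdeal.zero_mem _)
    (fun _ _ _ _ h h' => TwoSidedIdeal.add_mem _ h h')
    (fun _ _ h => TwoSidedIdeal.neg_mem _ h) hz

theorem exists_ne_zero {I : TwoSidedIdeal R} (hI : I ≠ ⊥) : ∃ x ∈ I, x ≠ 0 := by
  by_contra! h
  exact hI (TwoSidedIdeal.ext fun x =>
    ⟨fun hx => (TwoSidedIdeal.mem_bot R).2 (h x hx),
      fun hx => (TwoSidedIdeal.mem_bot R).1 hx ▸ I.zero_mem⟩)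

theorem idealMul_ne_bot [IsPrimeRing R] {I J : TwoSidedIdeal R} (hI : I ≠ ⊥) (hJ : J ≠ ⊥) :
    idealMul I J ≠ ⊥ := by
  obtain ⟨x, hx, hx0⟩ := exists_ne_zero hI
  obtain ⟨y, hy, hy0⟩ := exists_ne_zero hJ
  intro h
  rcases IsPrimeRing.eq_zero_or_eq_zero x y (fun r => by
    have := mul_mem_idealMul (I.mul_mem_right x r hx) hy
    rw [h] at this
    exact (TwoSidedIdeal.mem_bot R).1 this) with h0 | h0
  · exact hx0 h0
  · exact hy0 h0

theorem inf_ne_bot [IsPrimeRing R] {I J : TwoSidedIdeal R} (hI : I ≠ ⊥) (hJ : J ≠ ⊥) :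
    I ⊓ J ≠ ⊥ := by
  obtain ⟨x, hx, hx0⟩ := exists_ne_zero (idealMul_ne_bot hI hJ)
  intro h
  have hm : x ∈ I ⊓ J :=
    (TwoSidedIdeal.mem_inf R).2 ⟨idealMul_le_left _ _ hx, idealMul_le_right _ _ hx⟩
  rw [h] at hm
  exact hx0 ((TwoSidedIdeal.mem_bot R).1 hm)

theorem top_ne_bot [IsPrimeRing R] : (⊤ : TwoSidedIdeal R) ≠ ⊥ := by
  obtain ⟨x, hx⟩ := exists_ne (0 : R)
  intro h
  have hm : x ∈ (⊤ : TwoSidedIdeal R) := TwoSidedIdeal.mem_top R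
  rw [h] at hm
  exact hx ((TwoSidedIdeal.mem_bot R).1 hm)

end Ideals

/-- A balanced pair `(f, g)` on a nonzero ideal `I` of `R`: a homomorphism `f : I → R` of right
`R`-modules (think of `x ↦ q x`) and a homomorphism `g : I → R` of left `R`-modules (think of
`x ↦ x q`), with `g x * y = x * f y` for all `x, y ∈ I`. Only the restrictions of `f` and `g`
to `I` matter: values outside `I` are arbitrary, and are forgotten in the quotient below. -/
structure BalancedPair (R : Type*) [NonUnitalRing R] where
  dom : TwoSidedIdeal R
  dom_ne_bot : dom ≠ ⊥
  left : R → R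
  right : R → R
  left_add : ∀ x ∈ dom, ∀ y ∈ dom, left (x + y) = left x + left y
  right_add : ∀ x ∈ dom, ∀ y ∈ dom, right (x + y) = right x + right y
  left_mul : ∀ x ∈ dom, ∀ r : R, left (x * r) = left x * r
  right_mul : ∀ x ∈ dom, ∀ r : R, right (r * x) = r * right x
  balanced : ∀ x ∈ dom, ∀ y ∈ dom, right x * y = x * left y

namespace BalancedPair

variable {R : Type*} [NonUnitalRing R]

theorem left_zero (q : BalancedPair R) : q.left 0 = 0 := by
  have h := q.left_add 0 q.dom.zero_mem 0 q.dom.zero_mem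
  rw [add_zero] at h
  exact left_eq_add.1 h

theorem right_zero (q : BalancedPair R) : q.right 0 = 0 := by
  have h := q.right_add 0 q.dom.zero_mem 0 q.dom.zero_mem
  rw [add_zero] at h
  exact left_eq_add.1 h

theorem left_neg (q : BalancedPair R) {x : R} (hx : x ∈ q.dom) : q.left (-x) = -q.left x := by
  have h := q.left_add x hx (-x) (q.dom.neg_mem hx)
  rw [add_neg_cancel, left_zero] at h
  exact (neg_eq_of_add_eq_zero_right h.symm).symm

theorem right_neg (q : BalancedPair R) {x : R} (hx : x ∈ q.dom) :
    q.right (-x) = -q.right x := by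
  have h := q.right_add x hx (-x) (q.dom.neg_mem hx)
  rw [add_neg_cancel, right_zero] at h
  exact (neg_eq_of_add_eq_zero_right h.symm).symm

/-- If `J` lies in the domain, then `f (J I) ⊆ I`. -/
theorem left_mem (q : BalancedPair R) {I J : TwoSidedIdeal R} (hJ : ∀ x ∈ J, x ∈ q.dom)
    {z : R} (hz : z ∈ idealMul J I) : q.left z ∈ I := by
  refine idealMul_induction (p := fun z => q.left z ∈ I) ?_ ?_ ?_ ?_ hz
  · intro x hx y hy
    rw [q.left_mul x (hJ x hx)]
    exact I.mul_mem_left _ _ hy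
  · rw [left_zero]
    exact I.zero_mem
  · intro x hx y hy h h'
    rw [q.left_add x (hJ x (idealMul_le_left _ _ hx)) y (hJ y (idealMul_le_left _ _ hy))]
    exact I.add_mem h h'
  · intro x hx h
    rw [q.left_neg (hJ x (idealMul_le_left _ _ hx))]
    exact I.neg_mem h

/-- If `I` lies in the domain, then `g (J I) ⊆ J`. -/
theorem right_mem (q : BalancedPair R) {I J : TwoSidedIdeal R} (hI : ∀ x ∈ I, x ∈ q.dom)
    {z : R} (hz : z ∈ idealMul J I) : q.right z ∈ J := by
  refine idealMul_induction (p := fun z => q.right z ∈ J) ?_ ?_ ?_ ?_ hz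
  · intro x hx y hy
    rw [q.right_mul y (hI y hy)]
    exact J.mul_mem_right _ _ hx
  · rw [right_zero]
    exact J.zero_mem
  · intro x hx y hy h h'
    rw [q.right_add x (hI x (idealMul_le_right _ _ hx)) y (hI y (idealMul_le_right _ _ hy))]
    exact J.add_mem h h'
  · intro x hx h
    rw [q.right_neg (hI x (idealMul_le_right _ _ hx))]
    exact J.neg_mem h

variable [IsPrimeRing R]

/-- The pair of left and right multiplication by an element of `R`. -/
def of (a : R) : BalancedPair R where
  dom := ⊤
  dom_ne_bot := top_ne_bot
  left x := a * x
  right x := x * a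
  left_add _ _ _ _ := mul_add _ _ _
  right_add _ _ _ _ := add_mul _ _ _
  left_mul _ _ _ := (mul_assoc _ _ _).symm
  right_mul _ _ _ := mul_assoc _ _ _
  balanced _ _ _ _ := mul_assoc _ _ _

/-- The pair of identity maps. -/
def one : BalancedPair R where
  dom := ⊤
  dom_ne_bot := top_ne_bot
  left x := x
  right x := x
  left_add _ _ _ _ := rfl
  right_add _ _ _ _ := rfl
  left_mul _ _ _ := rfl
  right_mul _ _ _ := rfl
  balanced _ _ _ _ := rfl

/-- Pointwise negative. -/
def neg (q : BalancedPair R) : BalancedPair R where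
  dom := q.dom
  dom_ne_bot := q.dom_ne_bot
  left x := -q.left x
  right x := -q.right x
  left_add x hx y hy := by rw [q.left_add x hx y hy, neg_add]
  right_add x hx y hy := by rw [q.right_add x hx y hy, neg_add]
  left_mul x hx r := by rw [q.left_mul x hx, neg_mul]
  right_mul x hx r := by rw [q.right_mul x hx, mul_neg]
  balanced x hx y hy := by rw [neg_mul, mul_neg, q.balanced x hx y hy]

/-- Pointwise sum, on the intersection of the domains. -/
def add (q p : BalancedPair R) : BalancedPair R where
  dom := q.dom ⊓ p.dom
  dom_ne_bot := inf_ne_bot q.dom_ne_bot p.dom_ne_bot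
  left x := q.left x + p.left x
  right x := q.right x + p.right x
  left_add x hx y hy := by
    rw [TwoSidedIdeal.mem_inf] at hx hy
    rw [q.left_add x hx.1 y hy.1, p.left_add x hx.2 y hy.2]
    abel
  right_add x hx y hy := by
    rw [TwoSidedIdeal.mem_inf] at hx hy
    rw [q.right_add x hx.1 y hy.1, p.right_add x hx.2 y hy.2]
    abel
  left_mul x hx r := by
    rw [TwoSidedIdeal.mem_inf] at hx
    rw [q.left_mul x hx.1, p.left_mul x hx.2, add_mul]
  right_mul x hx r := by
    rw [TwoSidedIdeal.mem_inf] at hx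
    rw [q.right_mul x hx.1, p.right_mul x hx.2, mul_add]
  balanced x hx y hy := by
    rw [TwoSidedIdeal.mem_inf] at hx hy
    rw [add_mul, mul_add, q.balanced x hx.1 y hy.1, p.balanced x hx.2 y hy.2]

/-- Composition, on the product of the domains. -/
def mul (q p : BalancedPair R) : BalancedPair R where
  dom := idealMul p.dom q.dom
  dom_ne_bot := idealMul_ne_bot p.dom_ne_bot q.dom_ne_bot
  left x := q.left (p.left x)
  right x := p.right (q.right x)
  left_add x hx y hy := by
    rw [p.left_add x (idealMul_le_left _ _ hx) y (idealMul_le_left _ _ hy),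
      q.left_add _ (p.left_mem (fun _ h => h) hx) _ (p.left_mem (fun _ h => h) hy)]
  right_add x hx y hy := by
    rw [q.right_add x (idealMul_le_right _ _ hx) y (idealMul_le_right _ _ hy),
      p.right_add _ (q.right_mem (fun _ h => h) hx) _ (q.right_mem (fun _ h => h) hy)]
  left_mul x hx r := by
    rw [p.left_mul x (idealMul_le_left _ _ hx), q.left_mul _ (p.left_mem (fun _ h => h) hx)]
  right_mul x hx r := by
    rw [q.right_mul x (idealMul_le_right _ _ hx), p.right_mul _ (q.right_mem (fun _ h => h) hx)]
  balanced x hx y hy := by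
    rw [p.balanced _ (q.right_mem (fun _ h => h) hx) _ (idealMul_le_left _ _ hy),
      q.balanced _ (idealMul_le_right _ _ hx) _ (p.left_mem (fun _ h => h) hy)]

/-- Two balanced pairs are identified if they agree on some nonzero ideal contained in both
domains. -/
def Rel (q p : BalancedPair R) : Prop :=
  ∃ K : TwoSidedIdeal R, K ≠ ⊥ ∧
    ∀ x ∈ K, x ∈ q.dom ∧ x ∈ p.dom ∧ q.left x = p.left x ∧ q.right x = p.right x

theorem rel_of_eqOn {q p : BalancedPair R}
    (h : ∀ x ∈ q.dom, x ∈ p.dom → q.left x = p.left x ∧ q.right x = p.right x) : Rel q p :=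
  ⟨q.dom ⊓ p.dom, inf_ne_bot q.dom_ne_bot p.dom_ne_bot, fun x hx =>
    have hx := (TwoSidedIdeal.mem_inf R).1 hx
    ⟨hx.1, hx.2, h x hx.1 hx.2⟩⟩

instance setoid (R : Type*) [NonUnitalRing R] [IsPrimeRing R] : Setoid (BalancedPair R) where
  r := Rel
  iseqv :=
    { refl := fun _ => rel_of_eqOn fun _ _ _ => ⟨rfl, rfl⟩
      symm := by
        rintro q p ⟨K, hK, h⟩
        exact ⟨K, hK, fun x hx => ⟨(h x hx).2.1, (h x hx).1, (h x hx).2.2.1.symm,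
          (h x hx).2.2.2.symm⟩⟩
      trans := by
        rintro q p s ⟨K, hK, h⟩ ⟨K', hK', h'⟩
        refine ⟨K ⊓ K', inf_ne_bot hK hK', fun x hx => ?_⟩
        rw [TwoSidedIdeal.mem_inf] at hx
        obtain ⟨h1, -, h2, h3⟩ := h x hx.1
        obtain ⟨-, h4, h5, h6⟩ := h' x hx.2
        exact ⟨h1, h4, h2.trans h5, h3.trans h6⟩ }

theorem rel_neg {q p : BalancedPair R} (h : q ≈ p) : neg q ≈ neg p := by
  obtain ⟨K, hK, h⟩ := h
  refine ⟨K, hK, fun x hx => ?_⟩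
  obtain ⟨h1, h2, h3, h4⟩ := h x hx
  exact ⟨h1, h2, congrArg Neg.neg h3, congrArg Neg.neg h4⟩

theorem rel_add {q p q' p' : BalancedPair R} (h : q ≈ p) (h' : q' ≈ p') :
    add q q' ≈ add p p' := by
  obtain ⟨K, hK, h⟩ := h
  obtain ⟨K', hK', h'⟩ := h'
  refine ⟨K ⊓ K', inf_ne_bot hK hK', fun x hx => ?_⟩
  rw [TwoSidedIdeal.mem_inf] at hx
  obtain ⟨h1, h2, h3, h4⟩ := h x hx.1
  obtain ⟨h1', h2', h3', h4'⟩ := h' x hx.2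
  exact ⟨(TwoSidedIdeal.mem_inf R).2 ⟨h1, h1'⟩, (TwoSidedIdeal.mem_inf R).2 ⟨h2, h2'⟩,
    congrArg₂ (· + ·) h3 h3', congrArg₂ (· + ·) h4 h4'⟩

theorem rel_mul {q p q' p' : BalancedPair R} (h : q ≈ p) (h' : q' ≈ p') :
    mul q q' ≈ mul p p' := by
  obtain ⟨K, hK, h⟩ := h
  obtain ⟨K', hK', h'⟩ := h'
  refine ⟨idealMul K' K, idealMul_ne_bot hK' hK, fun x hx => ⟨?_, ?_, ?_, ?_⟩⟩
  · exact idealMul_mono (fun y hy => (h' y hy).1) (fun y hy => (h y hy).1) hx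
  · exact idealMul_mono (fun y hy => (h' y hy).2.1) (fun y hy => (h y hy).2.1) hx
  · change q.left (q'.left x) = p.left (p'.left x)
    rw [(h _ (q'.left_mem (fun y hy => (h' y hy).1) hx)).2.2.1,
      (h' x (idealMul_le_left _ _ hx)).2.2.1]
  · change q'.right (q.right x) = p'.right (p.right x)
    rw [(h' _ (q.right_mem (fun y hy => (h y hy).1) hx)).2.2.2,
      (h x (idealMul_le_right _ _ hx)).2.2.2]

end BalancedPair

/-- The Martindale symmetric ring of quotients `Q_s(R)` of a prime ring `R`. -/
def SymmQuotient (R : Type*) [NonUnitalRing R] [IsPrimeRing R] : Type _ :=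
  Quotient (BalancedPair.setoid R)

namespace SymmQuotient

open BalancedPair

variable {R : Type*} [NonUnitalRing R] [IsPrimeRing R]

/-- The class of a balanced pair. -/
def mk (q : BalancedPair R) : SymmQuotient R := Quotient.mk _ q

theorem mk_eq {q p : BalancedPair R}
    (h : ∀ x ∈ q.dom, x ∈ p.dom → q.left x = p.left x ∧ q.right x = p.right x) :
    mk q = mk p :=
  Quotient.sound (rel_of_eqOn h)

instance : Zero (SymmQuotient R) := ⟨mk (of 0)⟩
instance : One (SymmQuotient R) := ⟨mk one⟩
instance : Neg (SymmQuotient R) := ⟨Quotient.map neg fun _ _ h => rel_neg h⟩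
instance : Add (SymmQuotient R) := ⟨Quotient.map₂ add fun _ _ h _ _ h' => rel_add h h'⟩
instance : Mul (SymmQuotient R) := ⟨Quotient.map₂ mul fun _ _ h _ _ h' => rel_mul h h'⟩

instance : Ring (SymmQuotient R) where
  add_assoc := by
    rintro ⟨a⟩ ⟨b⟩ ⟨c⟩
    exact mk_eq (q := add (add a b) c) (p := add a (add b c))
      fun x _ _ => ⟨add_assoc _ _ _, add_assoc _ _ _⟩
  zero_add := by
    rintro ⟨a⟩
    refine mk_eq (q := add (of 0) a) (p := a) fun x _ _ => ⟨?_, ?_⟩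
    · change 0 * x + a.left x = a.left x
      rw [zero_mul, zero_add]
    · change x * 0 + a.right x = a.right x
      rw [mul_zero, zero_add]
  add_zero := by
    rintro ⟨a⟩
    refine mk_eq (q := add a (of 0)) (p := a) fun x _ _ => ⟨?_, ?_⟩
    · change a.left x + 0 * x = a.left x
      rw [zero_mul, add_zero]
    · change a.right x + x * 0 = a.right x
      rw [mul_zero, add_zero]
  add_comm := by
    rintro ⟨a⟩ ⟨b⟩
    exact mk_eq (q := add a b) (p := add b a) fun x _ _ => ⟨add_comm _ _, add_comm _ _⟩
  neg_add_cancel := by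
    rintro ⟨a⟩
    refine mk_eq (q := add (neg a) a) (p := of 0) fun x _ _ => ⟨?_, ?_⟩
    · change -a.left x + a.left x = 0 * x
      rw [zero_mul, neg_add_cancel]
    · change -a.right x + a.right x = x * 0
      rw [mul_zero, neg_add_cancel]
  mul_assoc := by
    rintro ⟨a⟩ ⟨b⟩ ⟨c⟩
    exact mk_eq (q := mul (mul a b) c) (p := mul a (mul b c)) fun x _ _ => ⟨rfl, rfl⟩
  one_mul := by
    rintro ⟨a⟩
    exact mk_eq (q := mul one a) (p := a) fun x _ _ => ⟨rfl, rfl⟩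
  mul_one := by
    rintro ⟨a⟩
    exact mk_eq (q := mul a one) (p := a) fun x _ _ => ⟨rfl, rfl⟩
  zero_mul := by
    rintro ⟨a⟩
    refine mk_eq (q := mul (of 0) a) (p := of 0) fun x _ _ => ⟨?_, ?_⟩
    · change 0 * a.left x = 0 * x
      rw [zero_mul, zero_mul]
    · change a.right (x * 0) = x * 0
      rw [mul_zero, right_zero]
  mul_zero := by
    rintro ⟨a⟩
    refine mk_eq (q := mul a (of 0)) (p := of 0) fun x _ _ => ⟨?_, ?_⟩
    · change a.left (0 * x) = 0 * x
      rw [zero_mul, left_zero]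
    · change a.right x * 0 = x * 0
      rw [mul_zero, mul_zero]
  left_distrib := by
    rintro ⟨a⟩ ⟨b⟩ ⟨c⟩
    refine mk_eq (q := mul a (add b c)) (p := add (mul a b) (mul a c)) fun x _ hx => ⟨?_, rfl⟩
    have hx := (TwoSidedIdeal.mem_inf R).1 hx
    exact a.left_add _ (b.left_mem (fun _ h => h) hx.1) _ (c.left_mem (fun _ h => h) hx.2)
  right_distrib := by
    rintro ⟨a⟩ ⟨b⟩ ⟨c⟩
    refine mk_eq (q := mul (add a b) c) (p := add (mul a c) (mul b c)) fun x _ hx => ⟨rfl, ?_⟩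
    have hx := (TwoSidedIdeal.mem_inf R).1 hx
    exact c.right_add _ (a.right_mem (fun _ h => h) hx.1) _ (b.right_mem (fun _ h => h) hx.2)
  nsmul := nsmulRec
  zsmul := zsmulRec

/-- The embedding of `R` into `Q_s(R)`. -/
def ofRing (R : Type*) [NonUnitalRing R] [IsPrimeRing R] : R →ₙ+* SymmQuotient R where
  toFun a := mk (of a)
  map_zero' := rfl
  map_add' a b := mk_eq (q := of (a + b)) (p := add (of a) (of b))
    fun _ _ _ => ⟨add_mul _ _ _, mul_add _ _ _⟩
  map_mul' a b := mk_eq (q := of (a * b)) (p := mul (of a) (of b))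
    fun _ _ _ => ⟨mul_assoc _ _ _, (mul_assoc _ _ _).symm⟩

theorem ofRing_injective : Function.Injective (ofRing R) := by
  intro a b hab
  obtain ⟨K, hK, h⟩ := Quotient.exact hab
  obtain ⟨y, hy, hy0⟩ := exists_ne_zero hK
  rcases IsPrimeRing.eq_zero_or_eq_zero (a - b) y (fun r => by
    have h1 : a * (r * y) = b * (r * y) := (h _ (K.mul_mem_left r y hy)).2.2.1
    rw [mul_assoc, sub_mul, h1, sub_self]) with h0 | h0
  · exact sub_eq_zero.1 h0
  · exact absurd h0 hy0

end SymmQuotient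

end Martindale

/-- The extended centroid `C` of a prime ring `R`: the center of `Q_s(R)`. -/
def extendedCentroid (R : Type*) [NonUnitalRing R] [IsPrimeRing R] :
    Subring (Martindale.SymmQuotient R) :=
  Subring.center (Martindale.SymmQuotient R)

/-- `A C`, the additive subgroup of `Q_s(R)` generated by all products `a c` with `a ∈ A`,
`c ∈ C`. -/
def mulCentroid {R : Type*} [NonUnitalRing R] [IsPrimeRing R] (A : AddSubgroup R) :
    AddSubgroup (Martindale.SymmQuotient R) :=
  A.map (Martindale.SymmQuotient.ofRing R : R →+ Martindale.SymmQuotient R) * (extendedCentroid R).toAddSubgroup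

/-- The subset `C a + C` of `Q_s(R)`. -/
def centroidLine {R : Type*} [NonUnitalRing R] [IsPrimeRing R] (a : R) :
    Set (Martindale.SymmQuotient R) :=
  {x | ∃ c ∈ extendedCentroid R, ∃ d ∈ extendedCentroid R, x = c * Martindale.SymmQuotient.ofRing R a + d}

/-- An additive subgroup `L` of `R` is a *Lie ideal* if `[L, R] ⊆ L`. -/
def IsLieIdeal {R : Type*} [NonUnitalRing R] (L : AddSubgroup R) : Prop :=
  ∀ x ∈ L, ∀ r : R, x * r - r * x ∈ L

/-- `L` is *noncentral* if it is not contained in the center of `R`. -/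
def IsNoncentral {R : Type*} [NonUnitalRing R] (L : AddSubgroup R) : Prop :=
  ¬ (L : Set R) ⊆ NonUnitalSubring.center R

/-- `[A, B]`, the additive subgroup of `R` generated by all `a b - b a`, `a ∈ A`, `b ∈ B`. -/
def addCommutatorSubgroup {R : Type*} [NonUnitalRing R] (A B : AddSubgroup R) : AddSubgroup R :=
  AddSubgroup.closure {x | ∃ a ∈ A, ∃ b ∈ B, x = a * b - b * a}

/-- The product `A₀ A₁ ⋯ Aₘ` of `m + 1` additive subgroups, where the product of two is the
additive subgroup generated by all products of elements. -/
def prodSubgroups {R : Type*} [NonUnitalRing R] :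
    (m : ℕ) → (Fin (m + 1) → AddSubgroup R) → AddSubgroup R
  | 0, A => A 0
  | m + 1, A => prodSubgroups m (fun i => A i.castSucc) * A (Fin.last (m + 1))

/-! The commutator condition reduces to pairs of factors. If `t` commutes with every element of
`KL`, where `K` and `L` are nonzero Lie ideals, then `t` commutes with `K` and with `L`
(`IsLieIdeal.commute_left_of_commute_mul`, `IsLieIdeal.commute_right_of_commute_mul`). Induction on
the number of factors, used on each side in turn, shows that the two products commute exactly when
every `K j` commutes elementwise with every `L k`.

For commuting Lie ideals `K`, `L` with `a ∈ K` noncentral and `b ∈ L`, expanding `[a, [b, rs]] = 0`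
leads to `[a,r] u [b,t] = -[b,r] u [a,t]`. Martindale's lemma (`exists_ratio`) turns this into
`[b,r] = -c[a,r]` for one `c ∈ C`, so `b + ca ∈ C` and `L ⊆ Ca + C`. By symmetry `K ⊆ Cb + C` for
noncentral `b ∈ L`, and then `Cb + C = Ca + C`.

That `KC` is all of `Ca + C` amounts to `1 ∈ KC`. Since `K` is now commutative, `a²` is central, and
then some commutator `[a,r]` lies outside `Ca`. Writing `[a,r] = ca + d` with `d ≠ 0` and inverting
`d` in the field `C` produces `1`. The converse holds because elements of `Ca + C` commute. -/

namespace Martindale.SymmQuotient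

variable {R : Type*} [NonUnitalRing R] [IsPrimeRing R]

/-! ### The symmetric ring of quotients and Martindale's lemma -/

theorem exists_ideal_mul_ofRing (q : SymmQuotient R) :
    ∃ I : TwoSidedIdeal R, I ≠ ⊥ ∧ ∀ x ∈ I, ∃ y, q * ofRing R x = ofRing R y := by
  obtain ⟨q⟩ := q
  refine ⟨q.dom, q.dom_ne_bot, fun x hx => ⟨q.left x, ?_⟩⟩
  refine mk_eq (q := .mul q (.of x)) (p := .of (q.left x)) fun z hz _ => ⟨?_, ?_⟩
  · exact q.left_mul x hx z
  · exact q.balanced z (idealMul_le_right _ _ hz) x hx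

/-- The left map vanishes on `I ⊓ q.dom` by hypothesis. The right map follows by balance: `q.right x
* (r * y) = x * q.left (r * y) = 0` for all `r`, and primeness applies with a nonzero `y`. -/
theorem eq_zero_of_forall_mul_ofRing {q : SymmQuotient R} {I : TwoSidedIdeal R} (hI : I ≠ ⊥)
    (h : ∀ x ∈ I, q * ofRing R x = 0) : q = 0 := by
  obtain ⟨q⟩ := q
  have key : ∀ x ∈ I ⊓ q.dom, q.left x = 0 := by
    intro x hx
    rw [TwoSidedIdeal.mem_inf] at hx
    apply ofRing_injective
    rw [map_zero, ← h x hx.1]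
    symm
    refine mk_eq (q := .mul q (.of x)) (p := .of (q.left x)) fun z hz _ => ⟨?_, ?_⟩
    · exact q.left_mul x hx.2 z
    · exact q.balanced z (idealMul_le_right _ _ hz) x hx.2
  refine Quotient.sound ⟨I ⊓ q.dom, inf_ne_bot hI q.dom_ne_bot, fun x hx =>
    ⟨((TwoSidedIdeal.mem_inf R).1 hx).2, TwoSidedIdeal.mem_top R, ?_, ?_⟩⟩
  · exact (key x hx).trans (zero_mul x).symm
  · change q.right x = x * 0
    rw [mul_zero]
    obtain ⟨y, hy, hy0⟩ := exists_ne_zero (inf_ne_bot hI q.dom_ne_bot)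
    refine (IsPrimeRing.eq_zero_or_eq_zero (q.right x) y fun r => ?_).resolve_right hy0
    have hry := TwoSidedIdeal.mul_mem_left _ r y hy
    rw [mul_assoc, q.balanced x ((TwoSidedIdeal.mem_inf R).1 hx).2 _
      ((TwoSidedIdeal.mem_inf R).1 hry).2, key _ hry, mul_zero]

/-- Primeness of `R` extends to elements of `Q_s(R)` on the right. -/
theorem eq_zero_of_forall_ofRing_mul {a : R} (ha : a ≠ 0) {q : SymmQuotient R}
    (h : ∀ r, ofRing R a * ofRing R r * q = 0) : q = 0 := by
  obtain ⟨I, hI, hq⟩ := exists_ideal_mul_ofRing q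
  refine eq_zero_of_forall_mul_ofRing hI fun x hx => ?_
  obtain ⟨y, hy⟩ := hq x hx
  have : y = 0 := (IsPrimeRing.eq_zero_or_eq_zero a y fun r => by
    apply ofRing_injective
    rw [map_mul, map_mul, ← hy, ← mul_assoc, h r, zero_mul, map_zero]).resolve_left ha
  rw [hy, this, map_zero]

/-- An arbitrary `p` carries some nonzero ideal into `R`, so `pq` and `qp` can be compared there
using only that `q` commutes with `R`. -/
theorem mem_extendedCentroid_of_commute {q : SymmQuotient R}
    (h : ∀ r, q * ofRing R r = ofRing R r * q) : q ∈ extendedCentroid R := by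
  refine Subring.mem_center_iff.2 fun p => ?_
  obtain ⟨I, hI, hp⟩ := exists_ideal_mul_ofRing p
  rw [← sub_eq_zero]
  refine eq_zero_of_forall_mul_ofRing hI fun x hx => ?_
  obtain ⟨y, hy⟩ := hp x hx
  rw [sub_mul, mul_assoc, mul_assoc, hy, h, h, ← mul_assoc, hy, sub_self]

theorem commute_of_mem_extendedCentroid {c : SymmQuotient R} (hc : c ∈ extendedCentroid R)
    (q : SymmQuotient R) : c * q = q * c :=
  (Subring.mem_center_iff.1 hc q).symm

theorem ofRing_mem_extendedCentroid_iff {a : R} :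
    ofRing R a ∈ extendedCentroid R ↔ a ∈ NonUnitalSubring.center R := by
  rw [NonUnitalSubring.mem_center_iff]
  constructor
  · intro h r
    apply ofRing_injective
    rw [map_mul, map_mul, commute_of_mem_extendedCentroid h]
  · intro h
    refine mem_extendedCentroid_of_commute fun r => ?_
    rw [← map_mul, ← map_mul, h r]

theorem eq_zero_of_mem_extendedCentroid_of_mul_ofRing {c : SymmQuotient R}
    (hc : c ∈ extendedCentroid R) {a : R} (ha : a ≠ 0) (h : c * ofRing R a = 0) : c = 0 := by
  refine eq_zero_of_forall_ofRing_mul ha fun r => ?_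
  rw [← commute_of_mem_extendedCentroid hc, ← mul_assoc, h, zero_mul]

/-- The ideal of all `x` admitting `y` with `x u b = y u d` for all `u`. -/
def ratioIdeal {R : Type*} [NonUnitalRing R] (b d : R) : TwoSidedIdeal R :=
  TwoSidedIdeal.mk' {x : R | ∃ y, ∀ u, x * u * b = y * u * d}
    ⟨0, fun u => by simp⟩
    (by
      rintro x x' ⟨y, hy⟩ ⟨y', hy'⟩
      exact ⟨y + y', fun u => by simp only [add_mul, hy u, hy' u]⟩)
    (by
      rintro x ⟨y, hy⟩
      exact ⟨-y, fun u => by simp only [neg_mul, hy u]⟩)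
    (by
      rintro r x ⟨y, hy⟩
      exact ⟨r * y, fun u => by
        have := congrArg (r * ·) (hy u)
        simpa only [mul_assoc] using this⟩)
    (by
      rintro x r ⟨y, hy⟩
      exact ⟨y * r, fun u => by
        have := hy (r * u)
        simpa only [mul_assoc] using this⟩)

theorem mem_ratioIdeal {R : Type*} [NonUnitalRing R] {b d x : R} :
    x ∈ ratioIdeal b d ↔ ∃ y, ∀ u, x * u * b = y * u * d := by
  rw [ratioIdeal, TwoSidedIdeal.mem_mk']
  rfl

/-- Martindale's lemma: if `d ≠ 0`, all relations `x u b = y u d` (for all `u`) have a common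
ratio `y / x` in the extended centroid. -/
theorem exists_ratio (b : R) {d : R} (hd : d ≠ 0) :
    ∃ c ∈ extendedCentroid R, ∀ x y : R, (∀ u, x * u * b = y * u * d) →
      c * ofRing R x = ofRing R y := by
  classical
  by_cases hI : ratioIdeal b d = ⊥
  -- When the ideal is zero, every relation has `x = y = 0`, so any ratio works.
  · refine ⟨0, Subring.zero_mem _, fun x y h => ?_⟩
    have hx : x = 0 := by
      have : x ∈ ratioIdeal b d := mem_ratioIdeal.2 ⟨y, h⟩
      rwa [hI, TwoSidedIdeal.mem_bot] at this
    have hy : y = 0 := (IsPrimeRing.eq_zero_or_eq_zero y d fun u => by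
      rw [← h u, hx, zero_mul, zero_mul]).resolve_right hd
    rw [hx, hy, map_zero, mul_zero]
  have uniq : ∀ {x y y' : R}, (∀ u, x * u * b = y * u * d) → (∀ u, x * u * b = y' * u * d) →
      y = y' := by
    intro x y y' h h'
    refine sub_eq_zero.1 ((IsPrimeRing.eq_zero_or_eq_zero (y - y') d fun u => ?_).resolve_right hd)
    rw [sub_mul, sub_mul, ← h u, ← h' u, sub_self]
  have hex : ∀ x : R, ∃ y, x ∈ ratioIdeal b d → ∀ u, x * u * b = y * u * d := by
    intro x
    by_cases hx : x ∈ ratioIdeal b d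
    · obtain ⟨y, hy⟩ := mem_ratioIdeal.1 hx
      exact ⟨y, fun _ => hy⟩
    · exact ⟨0, fun h => absurd h hx⟩
  -- On the ideal, `f x` is the unique `y` related to `x`; uniqueness makes `f` a bimodule map, so
  -- it can serve as both halves of a balanced pair.
  choose f hf using hex
  have hfl : ∀ x ∈ ratioIdeal b d, ∀ r, f (x * r) = f x * r := by
    intro x hx r
    refine uniq (hf _ (TwoSidedIdeal.mul_mem_right _ x r hx)) fun u => ?_
    have := hf x hx (r * u)
    simpa only [mul_assoc] using this
  have hfr : ∀ x ∈ ratioIdeal b d, ∀ r, f (r * x) = r * f x := by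
    intro x hx r
    refine uniq (hf _ (TwoSidedIdeal.mul_mem_left _ r x hx)) fun u => ?_
    have := congrArg (r * ·) (hf x hx u)
    simpa only [mul_assoc] using this
  have hfa : ∀ x ∈ ratioIdeal b d, ∀ y ∈ ratioIdeal b d, f (x + y) = f x + f y := by
    intro x hx y hy
    refine uniq (hf _ (TwoSidedIdeal.add_mem _ hx hy)) fun u => ?_
    simp only [add_mul, hf x hx u, hf y hy u]
  let q : BalancedPair R :=
    { dom := ratioIdeal b d
      dom_ne_bot := hI
      left := f
      right := f
      left_add := hfa
      right_add := hfa
      left_mul := hfl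
      right_mul := hfr
      balanced := fun x hx y hy => by rw [← hfl x hx, hfr y hy] }
  have hq : ∀ x y : R, (∀ u, x * u * b = y * u * d) → mk q * ofRing R x = ofRing R y := by
    intro x y h
    have hx : x ∈ ratioIdeal b d := mem_ratioIdeal.2 ⟨y, h⟩
    have hy : f x = y := uniq (hf x hx) h
    refine mk_eq (q := .mul q (.of x)) (p := .of y) fun z hz _ => ⟨?_, ?_⟩
    · change f (x * z) = y * z
      rw [hfl x hx, hy]
    · change f z * x = z * y
      rw [← hfl z (idealMul_le_right _ _ hz), hfr x hx, hy]
  refine ⟨mk q, mem_extendedCentroid_of_commute fun r => ?_, hq⟩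
  refine mk_eq (q := .mul q (.of r)) (p := .mul (.of r) q) fun z hz hz' => ⟨?_, ?_⟩
  · exact hfr z (idealMul_le_left _ _ hz') r
  · exact (hfl z (idealMul_le_right _ _ hz) r).symm

/-- Once `c = ea`, the relation reads `a u (b - ed) = 0` for all `u`, and primeness gives the second
ratio. -/
theorem exists_ratio_of_mul_eq {a b c d : R} (ha : a ≠ 0) (hd : d ≠ 0)
    (h : ∀ u, a * u * b = c * u * d) :
    ∃ e ∈ extendedCentroid R, e * ofRing R a = ofRing R c ∧ e * ofRing R d = ofRing R b := by
  obtain ⟨e, he, H⟩ := exists_ratio b hd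
  refine ⟨e, he, H a c h, ?_⟩
  rw [← sub_eq_zero]
  refine eq_zero_of_forall_ofRing_mul ha fun r => ?_
  rw [mul_sub, ← mul_assoc, ← commute_of_mem_extendedCentroid he, ← mul_assoc,
    H a c h, ← map_mul, ← map_mul, ← map_mul, ← map_mul, h r, sub_self]

/-- The extended centroid is a field. -/
theorem exists_inverse {c : SymmQuotient R} (hc : c ∈ extendedCentroid R) (h0 : c ≠ 0) :
    ∃ e ∈ extendedCentroid R, e * c = 1 := by
  obtain ⟨I, hI, hq⟩ := exists_ideal_mul_ofRing c
  obtain ⟨x, hx, hx0⟩ := exists_ne_zero hI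
  obtain ⟨y, hy⟩ := hq x hx
  have hy0 : y ≠ 0 := by
    rintro rfl
    exact h0 (eq_zero_of_mem_extendedCentroid_of_mul_ofRing hc hx0 (by rw [hy, map_zero]))
  -- As `y = cx` with `c` central, `y u x = x u y` for all `u`; the ratio of `x` to `y` is the
  -- inverse of `c`.
  obtain ⟨e, he, h, -⟩ := exists_ratio_of_mul_eq hy0 hy0 (b := x) (c := x) fun u => by
    apply ofRing_injective
    simp only [map_mul, ← hy]
    rw [mul_assoc c, mul_assoc c, commute_of_mem_extendedCentroid hc, mul_assoc _ _ c,
      commute_of_mem_extendedCentroid hc]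
  refine ⟨e, he, sub_eq_zero.1 (eq_zero_of_mem_extendedCentroid_of_mul_ofRing
    (Subring.sub_mem _ (Subring.mul_mem _ he hc) (Subring.one_mem _)) hx0 ?_)⟩
  rw [sub_mul, one_mul, mul_assoc, hy, h, sub_self]

end Martindale.SymmQuotient

open Martindale SymmQuotient

theorem AddSubgroup.mul_mem_mul {R : Type*} [NonUnitalNonAssocRing R] {M N : AddSubgroup R} {m n : R}
    (hm : m ∈ M) (hn : n ∈ N) : m * n ∈ M * N :=
  AddSubmonoid.mul_mem_mul (M := M.toAddSubmonoid) (N := N.toAddSubmonoid) hm hn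

theorem AddSubgroup.mul_induction_on {R : Type*} [NonUnitalNonAssocRing R] {M N : AddSubgroup R}
    {C : R → Prop} {r : R} (hr : r ∈ M * N) (hm : ∀ m ∈ M, ∀ n ∈ N, C (m * n))
    (ha : ∀ x y, C x → C y → C (x + y)) : C r :=
  AddSubmonoid.mul_induction_on (M := M.toAddSubmonoid) (N := N.toAddSubmonoid) hr hm ha

/-! ### Lie ideals and centralizers of their products -/

section LieIdeals

variable {R : Type*} [NonUnitalRing R]

theorem IsLieIdeal.mul {K L : AddSubgroup R} (hK : IsLieIdeal K) (hL : IsLieIdeal L) :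
    IsLieIdeal (K * L) := by
  intro x hx r
  refine AddSubgroup.mul_induction_on (C := fun x => x * r - r * x ∈ K * L) hx
    (fun u hu v hv => ?_) (fun u v hu hv => ?_)
  · have h := add_mem (AddSubgroup.mul_mem_mul (hK u hu r) hv)
      (AddSubgroup.mul_mem_mul hu (hL v hv r))
    convert h using 1
    noncomm_ring
  · convert add_mem hu hv using 1
    noncomm_ring

theorem IsNoncentral.exists_notMem {L : AddSubgroup R} (hL : IsNoncentral L) :
    ∃ a ∈ L, a ∉ NonUnitalSubring.center R :=
  Set.not_subset.1 hL

theorem IsNoncentral.exists_ne_zero {L : AddSubgroup R} (hL : IsNoncentral L) :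
    ∃ a ∈ L, a ≠ 0 := by
  obtain ⟨a, ha, ha'⟩ := hL.exists_notMem
  exact ⟨a, ha, fun h => ha' (h ▸ zero_mem _)⟩

theorem exists_commutator_ne_zero {a : R} (ha : a ∉ NonUnitalSubring.center R) :
    ∃ r, a * r - r * a ≠ 0 := by
  by_contra! h
  exact ha (NonUnitalSubring.mem_center_iff.2 fun r => (sub_eq_zero.1 (h r)).symm)

theorem commute_of_mem_mul {K L : AddSubgroup R} {t : R} (hK : ∀ x ∈ K, Commute t x)
    (hL : ∀ y ∈ L, Commute t y) : ∀ z ∈ K * L, Commute t z := fun _ hz =>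
  AddSubgroup.mul_induction_on hz (fun x hx y hy => (hK x hx).mul_right (hL y hy))
    fun _ _ h h' => h.add_right h'

theorem addCommutatorSubgroup_eq_bot {A B : AddSubgroup R} :
    addCommutatorSubgroup A B = ⊥ ↔ ∀ a ∈ A, ∀ b ∈ B, Commute a b := by
  rw [addCommutatorSubgroup, AddSubgroup.closure_eq_bot_iff]
  constructor
  · intro h a ha b hb
    exact sub_eq_zero.1 (h ⟨a, ha, b, hb, rfl⟩)
  · rintro h _ ⟨a, ha, b, hb, rfl⟩
    exact sub_eq_zero.2 (h a ha b hb)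

variable [IsPrimeRing R]

/-- If `KL = 0`, then `xy = 0` and `x[y,r] = 0` give `x r y = 0` for all `r`, against primeness. -/
theorem IsLieIdeal.exists_mul_ne_zero {K L : AddSubgroup R} (hL : IsLieIdeal L)
    (hK0 : ∃ x ∈ K, x ≠ 0) (hL0 : ∃ y ∈ L, y ≠ 0) : ∃ z ∈ K * L, z ≠ 0 := by
  obtain ⟨x, hx, hx0⟩ := hK0
  obtain ⟨y, hy, hy0⟩ := hL0
  by_contra! h
  have h1 : x * y = 0 := h _ (AddSubgroup.mul_mem_mul hx hy)
  rcases IsPrimeRing.eq_zero_or_eq_zero x y fun r => by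
    have h2 := h _ (AddSubgroup.mul_mem_mul hx (hL y hy r))
    rw [mul_sub, ← mul_assoc, ← mul_assoc, h1, zero_mul, zero_sub, neg_eq_zero] at h2
    exact h2 with h | h
  · exact hx0 h
  · exact hy0 h

/-- An element acting as a scalar by left multiplication on a nonzero Lie ideal is central. -/
theorem IsLieIdeal.mem_center_of_left_scalar {K : AddSubgroup R} (hK : IsLieIdeal K)
    (hK0 : ∃ x ∈ K, x ≠ 0) {t : R} {c : SymmQuotient R} (hc : c ∈ extendedCentroid R)
    (h : ∀ x ∈ K, c * ofRing R x = ofRing R (t * x)) : t ∈ NonUnitalSubring.center R := by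
  obtain ⟨x, hx, hx0⟩ := hK0
  have ht : ofRing R t = c := by
    obtain ⟨I, hI, hq⟩ := exists_ideal_mul_ofRing (ofRing R t - c)
    rw [← sub_eq_zero]
    refine eq_zero_of_forall_mul_ofRing hI fun z hz => ?_
    obtain ⟨y, hy⟩ := hq z hz
    -- `t - c` kills both `x` and `[x,r]`, hence also `rx`. Since `t - c` need not lie in `R`,
    -- primeness is applied to `y = (t - c)z` instead.
    have key : ∀ r, (ofRing R t - c) * ofRing R r * ofRing R x = 0 := fun r => by
      have h1 := h x hx
      have h2 := h _ (hK x hx r)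
      simp only [map_mul, map_sub] at h1 h2
      have h3 : (ofRing R t - c) * ofRing R r * ofRing R x =
          -((ofRing R t * (ofRing R x * ofRing R r - ofRing R r * ofRing R x)
            - c * (ofRing R x * ofRing R r - ofRing R r * ofRing R x))
            + (c * ofRing R x - ofRing R t * ofRing R x) * ofRing R r) := by noncomm_ring
      rw [h3, h1, h2]
      simp
    have hy0 : y = 0 := (IsPrimeRing.eq_zero_or_eq_zero y x fun r => by
      apply ofRing_injective
      rw [map_mul, map_mul, ← hy, mul_assoc (ofRing R t - c), ← map_mul, key,
        map_zero]).resolve_right hx0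
    rw [hy, hy0, map_zero]
  rw [← ofRing_mem_extendedCentroid_iff, ht]
  exact hc

/-- Mirror image of `IsLieIdeal.mem_center_of_left_scalar`. -/
theorem IsLieIdeal.mem_center_of_right_scalar {K : AddSubgroup R} (hK : IsLieIdeal K)
    (hK0 : ∃ x ∈ K, x ≠ 0) {t : R} {c : SymmQuotient R} (hc : c ∈ extendedCentroid R)
    (h : ∀ x ∈ K, c * ofRing R x = ofRing R (x * t)) : t ∈ NonUnitalSubring.center R := by
  obtain ⟨x, hx, hx0⟩ := hK0
  have ht : ofRing R t = c := by
    rw [← sub_eq_zero]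
    refine eq_zero_of_forall_ofRing_mul hx0 fun r => ?_
    have h1 := h x hx
    have h2 := h _ (hK x hx r)
    rw [commute_of_mem_extendedCentroid hc] at h1 h2
    simp only [map_mul, map_sub] at h1 h2
    have h3 : ofRing R x * ofRing R r * (ofRing R t - c) =
        ((ofRing R x * ofRing R r - ofRing R r * ofRing R x) * ofRing R t
          - (ofRing R x * ofRing R r - ofRing R r * ofRing R x) * c)
          + ofRing R r * (ofRing R x * ofRing R t - ofRing R x * c) := by noncomm_ring
    rw [h3, h1, h2]
    simp
  rw [← ofRing_mem_extendedCentroid_iff, ht]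
  exact hc

/-- The identity `[x,rt]y - [x,r]yt = xr[t,y] - r[t,xy]` shows that `t` commutes with `xrw`, where
`w = [t,y]`. If `w ≠ 0`, comparing `x r (wt)` with `(tx) r w` gives one ratio `c` with `tx = cx` on
all of `K`, which forces `t` to be central. -/
theorem IsLieIdeal.commute_right_of_commute_mul {K L : AddSubgroup R} (hK : IsLieIdeal K)
    (hK0 : ∃ x ∈ K, x ≠ 0) {t : R} (h : ∀ z ∈ K * L, Commute t z) : ∀ y ∈ L, Commute t y := by
  intro y hy
  by_contra hne
  have hw : t * y - y * t ≠ 0 := fun h => hne (sub_eq_zero.1 h)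
  have key : ∀ x ∈ K, ∀ r, t * (x * r * (t * y - y * t)) = x * r * (t * y - y * t) * t := by
    intro x hx r
    have h0 : t * (x * y) = x * y * t := h _ (AddSubgroup.mul_mem_mul hx hy)
    have h1 : Commute t ((x * r - r * x) * y) := h _ (AddSubgroup.mul_mem_mul (hK x hx r) hy)
    have h2 := h _ (AddSubgroup.mul_mem_mul (hK x hx (r * t)) hy)
    have h3 := h2.sub_right (h1.mul_right (Commute.refl t))
    have h4 : (x * (r * t) - r * t * x) * y - (x * r - r * x) * y * t
        = x * r * (t * y - y * t) - r * (t * (x * y) - x * y * t) := by noncomm_ring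
    rw [h4, h0, sub_self, mul_zero, sub_zero] at h3
    exact h3
  obtain ⟨c, hc, H⟩ := exists_ratio ((t * y - y * t) * t) hw
  refine hne (NonUnitalSubring.mem_center_iff.1 (hK.mem_center_of_left_scalar hK0 hc
    fun x hx => H x (t * x) fun u => ?_) y).symm
  simpa only [mul_assoc] using (key x hx u).symm

/-- The mirror argument, with `w = [t,x]` and `t` commuting with `wry`. Here the ratio is extracted
separately for each `y`, so its independence of `y` must be proved. -/
theorem IsLieIdeal.commute_left_of_commute_mul {K L : AddSubgroup R} (hL : IsLieIdeal L)
    (hL0 : ∃ x ∈ L, x ≠ 0) {t : R} (h : ∀ z ∈ K * L, Commute t z) : ∀ x ∈ K, Commute t x := by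
  intro x hx
  by_contra hne
  have hw : t * x - x * t ≠ 0 := fun h => hne (sub_eq_zero.1 h)
  have key : ∀ y ∈ L, ∀ r, t * ((t * x - x * t) * r * y) = (t * x - x * t) * r * y * t := by
    intro y hy r
    have h0 : t * (x * y) = x * y * t := h _ (AddSubgroup.mul_mem_mul hx hy)
    have h1 : Commute t (x * (y * r - r * y)) := h _ (AddSubgroup.mul_mem_mul hx (hL y hy r))
    have h2 := h _ (AddSubgroup.mul_mem_mul hx (hL y hy (t * r)))
    have h3 := ((Commute.refl t).mul_right h1).sub_right h2
    have h4 : t * (x * (y * r - r * y)) - x * (y * (t * r) - t * r * y)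
        = (t * (x * y) - x * y * t) * r - (t * x - x * t) * r * y := by noncomm_ring
    rw [h4, h0, sub_self, zero_mul, zero_sub] at h3
    exact Commute.neg_right_iff.1 h3
  obtain ⟨y, hy, hy0⟩ := hL0
  have hex : ∀ y ∈ L, y ≠ 0 → ∃ c ∈ extendedCentroid R,
      c * ofRing R (t * x - x * t) = ofRing R (t * (t * x - x * t)) ∧
        c * ofRing R y = ofRing R (y * t) := fun y hy hy0 =>
    exists_ratio_of_mul_eq hw hy0 fun u => by simpa only [mul_assoc] using (key y hy u).symm
  obtain ⟨c, hc, h1, -⟩ := hex y hy hy0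
  refine hne (NonUnitalSubring.mem_center_iff.1 (hL.mem_center_of_right_scalar ⟨y, hy, hy0⟩ hc
    fun z hz => ?_) x).symm
  by_cases hz0 : z = 0
  · simp [hz0]
  obtain ⟨e, he, h2, h3⟩ := hex z hz hz0
  -- Both ratios satisfy `ew = tw = cw` for the same nonzero `w`, so they coincide.
  have hec : e - c = 0 := eq_zero_of_mem_extendedCentroid_of_mul_ofRing
    (Subring.sub_mem _ he hc) hw (by rw [sub_mul, h1, h2, sub_self])
  rw [← sub_eq_zero.1 hec, h3]

theorem isLieIdeal_prodSubgroups {R : Type*} [NonUnitalRing R] : ∀ (m : ℕ)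
    (K : Fin (m + 1) → AddSubgroup R), (∀ j, IsLieIdeal (K j)) → IsLieIdeal (prodSubgroups m K)
  | 0, _, hK => hK 0
  | m + 1, _, hK => (isLieIdeal_prodSubgroups m _ fun _ => hK _).mul (hK _)

theorem exists_prodSubgroups_ne_zero : ∀ (m : ℕ) (K : Fin (m + 1) → AddSubgroup R),
    (∀ j, IsLieIdeal (K j)) → (∀ j, ∃ x ∈ K j, x ≠ 0) → ∃ z ∈ prodSubgroups m K, z ≠ 0
  | 0, _, _, h => h 0
  | m + 1, _, hK, h =>
    (hK _).exists_mul_ne_zero (exists_prodSubgroups_ne_zero m _ (fun _ => hK _) fun _ => h _) (h _)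

theorem commute_prodSubgroups_iff {t : R} : ∀ (m : ℕ) (K : Fin (m + 1) → AddSubgroup R),
    (∀ j, IsLieIdeal (K j)) → (∀ j, ∃ x ∈ K j, x ≠ 0) →
      ((∀ z ∈ prodSubgroups m K, Commute t z) ↔ ∀ j, ∀ x ∈ K j, Commute t x)
  | 0, K, _, _ => ⟨fun h j => by rwa [Fin.fin_one_eq_zero j], fun h => h 0⟩
  | m + 1, K, hK, h0 => by
    have ih := commute_prodSubgroups_iff (t := t) m (fun i => K i.castSucc) (fun _ => hK _)
      fun _ => h0 _
    constructor
    · intro h j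
      refine Fin.lastCases ?_ (fun i => ?_) j
      · exact (isLieIdeal_prodSubgroups m _ fun _ => hK _).commute_right_of_commute_mul
          (exists_prodSubgroups_ne_zero m _ (fun _ => hK _) fun _ => h0 _) h
      · exact ih.1 ((hK _).commute_left_of_commute_mul (h0 _) h) i
    · intro h
      exact commute_of_mem_mul (ih.2 fun i => h _) (h _)

theorem commute_prodSubgroups_prodSubgroups_iff {m n : ℕ} {K : Fin (m + 1) → AddSubgroup R}
    {L : Fin (n + 1) → AddSubgroup R}
    (hK : ∀ j, IsLieIdeal (K j)) (hK0 : ∀ j, ∃ x ∈ K j, x ≠ 0)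
    (hL : ∀ k, IsLieIdeal (L k)) (hL0 : ∀ k, ∃ x ∈ L k, x ≠ 0) :
    (∀ x ∈ prodSubgroups m K, ∀ y ∈ prodSubgroups n L, Commute x y) ↔
      ∀ j k, ∀ x ∈ K j, ∀ y ∈ L k, Commute x y := by
  simp only [commute_prodSubgroups_iff n L hL hL0]
  constructor
  · intro h j k x hx y hy
    exact ((commute_prodSubgroups_iff m K hK hK0).1 (fun x hx => (h x hx k y hy).symm) j x hx).symm
  · intro h x hx k y hy
    exact ((commute_prodSubgroups_iff m K hK hK0).2
      (fun j x hx => (h j k x hx y hy).symm) x hx).symm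

/-! ### Commuting Lie ideals -/

theorem mem_centroidLine_of_commute {K L : AddSubgroup R} (hL : IsLieIdeal L)
    (h : ∀ x ∈ K, ∀ y ∈ L, Commute x y) {a b : R} (ha : a ∈ K)
    (ha' : a ∉ NonUnitalSubring.center R) (hb : b ∈ L) : ofRing R b ∈ centroidLine a := by
  obtain ⟨t, ht⟩ := exists_commutator_ne_zero ha'
  -- Leibniz expansion of `[a, [b, rs]] = 0`, using `[a, [b, r]] = [a, [b, s]] = 0`.
  have E : ∀ r s, (a * r - r * a) * (b * s - s * b) + (b * r - r * b) * (a * s - s * a) = 0 := by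
    intro r s
    have h1 := sub_eq_zero.2 (h a ha _ (hL b hb (r * s))).eq
    have h2 := sub_eq_zero.2 (h a ha _ (hL b hb r)).eq
    have h3 := sub_eq_zero.2 (h a ha _ (hL b hb s)).eq
    have : (a * r - r * a) * (b * s - s * b) + (b * r - r * b) * (a * s - s * a) =
        (a * (b * (r * s) - r * s * b) - (b * (r * s) - r * s * b) * a)
        - (a * (b * r - r * b) - (b * r - r * b) * a) * s
        - r * (a * (b * s - s * b) - (b * s - s * b) * a) := by noncomm_ring
    rw [this, h1, h2, h3, mul_zero, zero_mul, sub_zero, sub_zero]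
  -- Put `ut` for `s` in `E` and subtract `E r u` times `t`.
  have F : ∀ r u, (a * r - r * a) * u * (b * t - t * b) =
      -(b * r - r * b) * u * (a * t - t * a) := by
    intro r u
    have h1 := E r (u * t)
    have h2 := E r u
    have : (a * r - r * a) * u * (b * t - t * b) - -(b * r - r * b) * u * (a * t - t * a) =
        ((a * r - r * a) * (b * (u * t) - u * t * b) + (b * r - r * b) * (a * (u * t) - u * t * a))
        - ((a * r - r * a) * (b * u - u * b) + (b * r - r * b) * (a * u - u * a)) * t := by
      noncomm_ring
    rw [← sub_eq_zero, this, h1, h2, zero_mul, sub_zero]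
  obtain ⟨c, hc, H⟩ := exists_ratio (b * t - t * b) ht
  -- The ratio gives `c[a,r] = -[b,r]`, that is, `b + ca` commutes with `R`.
  have hd : ofRing R b + c * ofRing R a ∈ extendedCentroid R := by
    refine mem_extendedCentroid_of_commute fun r => ?_
    have := H _ _ (F r)
    simp only [map_neg, map_sub, map_mul] at this
    rw [mul_sub, ← mul_assoc, ← mul_assoc, commute_of_mem_extendedCentroid hc (ofRing R r),
      mul_assoc (ofRing R r)] at this
    rw [add_mul, mul_add, ← sub_eq_zero]
    have h2 := congrArg (· + (ofRing R b * ofRing R r - ofRing R r * ofRing R b)) this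
    simp only [neg_add_cancel] at h2
    rw [← h2]
    abel
  refine ⟨-c, Subring.neg_mem _ hc, _, hd, ?_⟩
  rw [neg_mul]
  abel

theorem subset_centroidLine_trans {a b : R} (hb : ofRing R b ∈ centroidLine a) :
    (centroidLine b : Set (SymmQuotient R)) ⊆ centroidLine a := by
  rintro _ ⟨c, hc, d, hd, rfl⟩
  obtain ⟨e, he, f, hf, hb⟩ := hb
  refine ⟨c * e, Subring.mul_mem _ hc he, c * f + d,
    Subring.add_mem _ (Subring.mul_mem _ hc hf) hd, ?_⟩
  rw [hb, mul_add, mul_assoc, add_assoc]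

theorem commute_of_mem_centroidLine {a : R} {x y : SymmQuotient R} (hx : x ∈ centroidLine a)
    (hy : y ∈ centroidLine a) : Commute x y := by
  obtain ⟨c, hc, d, hd, rfl⟩ := hx
  obtain ⟨e, he, f, hf, rfl⟩ := hy
  have hc' : ∀ {c : SymmQuotient R}, c ∈ extendedCentroid R → ∀ q, Commute c q :=
    fun hc q => commute_of_mem_extendedCentroid hc q
  have ha : Commute (c * ofRing R a) (e * ofRing R a) :=
    (hc' hc _).mul_left ((hc' he _).symm.mul_right (Commute.refl _))
  exact (ha.add_right (hc' hf _).symm).add_left ((hc' hd _))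

theorem mulCentroid_subset_centroidLine {K : AddSubgroup R} {a : R}
    (h : ∀ x ∈ K, ofRing R x ∈ centroidLine a) :
    (mulCentroid K : Set (SymmQuotient R)) ⊆ centroidLine a := by
  intro z hz
  refine AddSubgroup.mul_induction_on hz ?_ ?_
  · rintro _ ⟨x, hx, rfl⟩ c hc
    obtain ⟨e, he, f, hf, hx⟩ := h x hx
    refine ⟨c * e, Subring.mul_mem _ hc he, c * f, Subring.mul_mem _ hc hf, ?_⟩
    rw [← commute_of_mem_extendedCentroid hc, mul_assoc, ← mul_add]
    exact congrArg (c * ·) hx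
  · rintro _ _ ⟨c, hc, d, hd, rfl⟩ ⟨e, he, f, hf, rfl⟩
    exact ⟨c + e, Subring.add_mem _ hc he, d + f, Subring.add_mem _ hd hf, by
      rw [add_mul]; abel⟩

/-! ### Recovering all of `Ca + C` from a commutative Lie ideal -/

theorem ofRing_mul_mem_mulCentroid {K : AddSubgroup R} {x : R} (hx : x ∈ K) {c : SymmQuotient R}
    (hc : c ∈ extendedCentroid R) : ofRing R x * c ∈ mulCentroid K :=
  AddSubgroup.mul_mem_mul (AddSubgroup.mem_map_of_mem _ hx) hc

theorem ofRing_mem_mulCentroid {K : AddSubgroup R} {x : R} (hx : x ∈ K) :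
    ofRing R x ∈ mulCentroid K := by
  have := ofRing_mul_mem_mulCentroid hx (Subring.one_mem _)
  rwa [mul_one] at this

/-- Taking `b = a` in the previous argument gives `2[a,r] u [a,r] = 0`, so `2[a,r] = 0` by
primeness. Then `[a²,r] = [a,[a,r]] + 2[a,r]a = 0`. -/
theorem mul_self_mem_center {K : AddSubgroup R} (hK : IsLieIdeal K)
    (h : ∀ x ∈ K, ∀ y ∈ K, Commute x y) {a : R} (ha : a ∈ K) :
    a * a ∈ NonUnitalSubring.center R := by
  have E : ∀ r s, (a * r - r * a) * (a * s - s * a) + (a * r - r * a) * (a * s - s * a) = 0 := by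
    intro r s
    have h1 := sub_eq_zero.2 (h a ha _ (hK a ha (r * s))).eq
    have h2 := sub_eq_zero.2 (h a ha _ (hK a ha r)).eq
    have h3 := sub_eq_zero.2 (h a ha _ (hK a ha s)).eq
    have : (a * r - r * a) * (a * s - s * a) + (a * r - r * a) * (a * s - s * a) =
        (a * (a * (r * s) - r * s * a) - (a * (r * s) - r * s * a) * a)
        - (a * (a * r - r * a) - (a * r - r * a) * a) * s
        - r * (a * (a * s - s * a) - (a * s - s * a) * a) := by noncomm_ring
    rw [this, h1, h2, h3, mul_zero, zero_mul, sub_zero, sub_zero]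
  have two : ∀ r, (a * r - r * a) + (a * r - r * a) = 0 := by
    intro r
    by_contra hne
    have : a * r - r * a = 0 := (IsPrimeRing.eq_zero_or_eq_zero _ (a * r - r * a) fun u => by
      have h1 := E r (u * r)
      have h2 := E r u
      have : ((a * r - r * a) + (a * r - r * a)) * u * (a * r - r * a) =
          ((a * r - r * a) * (a * (u * r) - u * r * a)
            + (a * r - r * a) * (a * (u * r) - u * r * a))
          - ((a * r - r * a) * (a * u - u * a) + (a * r - r * a) * (a * u - u * a)) * r := by
        noncomm_ring
      rw [this, h1, h2, zero_mul, sub_zero]).resolve_left hne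
    exact hne (by rw [this, add_zero])
  refine NonUnitalSubring.mem_center_iff.2 fun r => ?_
  have h1 := sub_eq_zero.2 (h a ha _ (hK a ha r)).eq
  have : r * (a * a) - a * a * r = -(a * (a * r - r * a) - (a * r - r * a) * a)
      - ((a * r - r * a) + (a * r - r * a)) * a := by noncomm_ring
  rw [← sub_eq_zero, this, h1, two, zero_mul, neg_zero, sub_zero]

/-- Not all commutators with a noncentral square-central element `a` are multiples of `a`. -/
theorem exists_commutator_ne_mul {a : R} (ha : a ∉ NonUnitalSubring.center R)
    (haa : a * a ∈ NonUnitalSubring.center R) :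
    ∃ r, ∀ c ∈ extendedCentroid R, ofRing R (a * r - r * a) ≠ c * ofRing R a := by
  by_contra! h
  have ha0 : a ≠ 0 := fun h0 => ha (h0 ▸ zero_mem _)
  obtain ⟨t, ht⟩ := exists_commutator_ne_zero ha
  -- With `[a,t] = ca ≠ 0`, the commutator `[a,ta] = [a,t]a` gives `ea = ca²`. If `e ≠ 0`, then `a =
  -- e⁻¹ca²` would be central; hence `ca² = 0` with `c ≠ 0`.
  have hsq : a * a = 0 := by
    obtain ⟨c, hc, h1⟩ := h t
    obtain ⟨e, he, h2⟩ := h (t * a)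
    have h3 : e * ofRing R a = c * ofRing R (a * a) := by
      rw [← h2, map_mul, ← mul_assoc c, ← h1, ← map_mul, sub_mul, mul_assoc, mul_assoc]
    have hc0 : c ≠ 0 := by
      rintro rfl
      rw [zero_mul] at h1
      exact ht (ofRing_injective (h1.trans (map_zero _).symm))
    have he0 : e = 0 := by
      by_contra he0
      obtain ⟨f, hf, hfe⟩ := exists_inverse he he0
      refine ha (ofRing_mem_extendedCentroid_iff.1 ?_)
      rw [← one_mul (ofRing R a), ← hfe, mul_assoc, h3]
      exact Subring.mul_mem _ hf (Subring.mul_mem _ hc (ofRing_mem_extendedCentroid_iff.2 haa))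
    by_contra hne
    exact hc0 (eq_zero_of_mem_extendedCentroid_of_mul_ofRing hc hne (by rw [← h3, he0, zero_mul]))
  -- Since `a² = 0`, multiplying `[a,r] = ca` by `a` on the left leaves `-ara = 0`.
  refine ha0 ((or_self_iff).1 (IsPrimeRing.eq_zero_or_eq_zero a a fun r => ?_))
  obtain ⟨c, hc, h1⟩ := h r
  have h2 : ofRing R a * _ = ofRing R a * _ := congrArg (ofRing R a * ·) h1
  rw [← mul_assoc, ← commute_of_mem_extendedCentroid hc, mul_assoc, ← map_mul, ← map_mul, hsq,
    map_zero, mul_zero, mul_sub, ← mul_assoc, hsq, zero_mul, zero_sub] at h2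
  rw [mul_assoc, ← neg_eq_zero]
  exact ofRing_injective (h2.trans (map_zero _).symm)

theorem centroidLine_subset_mulCentroid {K : AddSubgroup R} (hK : IsLieIdeal K)
    {a : R} (ha : a ∈ K) (ha' : a ∉ NonUnitalSubring.center R)
    (h : ∀ x ∈ K, ofRing R x ∈ centroidLine a) :
    (centroidLine a : Set (SymmQuotient R)) ⊆ mulCentroid K := by
  have hcomm : ∀ x ∈ K, ∀ y ∈ K, Commute x y := fun x hx y hy => by
    apply ofRing_injective
    rw [map_mul, map_mul]
    exact commute_of_mem_centroidLine (h x hx) (h y hy)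
  obtain ⟨r, hr⟩ := exists_commutator_ne_mul ha' (mul_self_mem_center hK hcomm ha)
  obtain ⟨c, hc, d, hd, hcd⟩ := h _ (hK a ha r)
  have hd0 : d ≠ 0 := by
    rintro rfl
    exact hr c hc (by rw [hcd, add_zero])
  obtain ⟨e, he, hed⟩ := exists_inverse hd hd0
  rintro _ ⟨f, hf, g, hg, rfl⟩
  -- With `e = d⁻¹`, the scalar `g` equals `([a,r] - ca)eg`, and the two terms in `a` are collected.
  have : f * ofRing R a + g = ofRing R a * (f - c * (e * g))
      + ofRing R (a * r - r * a) * (e * g) := by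
    rw [hcd, add_mul, ← mul_assoc d, ← commute_of_mem_extendedCentroid he, hed, one_mul, mul_sub,
      commute_of_mem_extendedCentroid hf, commute_of_mem_extendedCentroid hc (ofRing R a),
      mul_assoc]
    abel
  rw [this]
  have heg := Subring.mul_mem _ he hg
  exact add_mem (ofRing_mul_mem_mulCentroid ha (Subring.sub_mem _ hf (Subring.mul_mem _ hc heg)))
    (ofRing_mul_mem_mulCentroid (hK a ha r) heg)

theorem mulCentroid_eq_centroidLine_of_commute {K L : AddSubgroup R} (hK : IsLieIdeal K)
    (hL : IsLieIdeal L) (hL_nc : IsNoncentral L) (h : ∀ x ∈ K, ∀ y ∈ L, Commute x y) {a : R}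
    (ha : a ∈ K) (ha' : a ∉ NonUnitalSubring.center R) :
    (mulCentroid K : Set (SymmQuotient R)) = centroidLine a ∧
      (mulCentroid L : Set (SymmQuotient R)) = centroidLine a := by
  obtain ⟨b, hb, hb'⟩ := hL_nc.exists_notMem
  have hL_sub : ∀ y ∈ L, ofRing R y ∈ centroidLine a := fun y hy =>
    mem_centroidLine_of_commute hL h ha ha' hy
  have hK_sub : ∀ x ∈ K, ofRing R x ∈ centroidLine b := fun x hx =>
    mem_centroidLine_of_commute hK (fun y hy x hx => (h x hx y hy).symm) hb hb' hx
  have hab : (centroidLine a : Set (SymmQuotient R)) = centroidLine b :=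
    (subset_centroidLine_trans (hK_sub a ha)).antisymm (subset_centroidLine_trans (hL_sub b hb))
  rw [← hab] at hK_sub
  rw [Set.Subset.antisymm_iff, Set.Subset.antisymm_iff]
  refine ⟨⟨mulCentroid_subset_centroidLine hK_sub,
    centroidLine_subset_mulCentroid hK ha ha' hK_sub⟩,
    mulCentroid_subset_centroidLine hL_sub, ?_⟩
  rw [hab] at hL_sub ⊢
  exact centroidLine_subset_mulCentroid hL hb hb' hL_sub

end LieIdeals

theorem theoremE {R : Type*} [NonUnitalRing R] [IsPrimeRing R] (m n : ℕ)
    (K : Fin (m + 1) → AddSubgroup R) (L : Fin (n + 1) → AddSubgroup R)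
    (hK : ∀ j, IsLieIdeal (K j)) (hK_nc : ∀ j, IsNoncentral (K j))
    (hL : ∀ k, IsLieIdeal (L k)) (hL_nc : ∀ k, IsNoncentral (L k)) :
    addCommutatorSubgroup (prodSubgroups m K) (prodSubgroups n L) = ⊥ ↔
      ∀ j k, ∀ a ∈ K 0, a ∉ NonUnitalSubring.center R →
        mulCentroid (K 0) = mulCentroid (K j) ∧
        mulCentroid (K j) = mulCentroid (L k) ∧
        (mulCentroid (L k) : Set (Martindale.SymmQuotient R)) = centroidLine a := by
  rw [addCommutatorSubgroup_eq_bot, commute_prodSubgroups_prodSubgroups_iff hK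
    (fun j => (hK_nc j).exists_ne_zero) hL fun k => (hL_nc k).exists_ne_zero]
  constructor
  · intro h j k a ha ha'
    obtain ⟨h1, h2⟩ :=
      mulCentroid_eq_centroidLine_of_commute (hK 0) (hL k) (hL_nc k) (h 0 k) ha ha'
    obtain ⟨b, hb, hb'⟩ := (hK_nc j).exists_notMem
    obtain ⟨h3, h4⟩ :=
      mulCentroid_eq_centroidLine_of_commute (hK j) (hL k) (hL_nc k) (h j k) hb hb'
    have h5 : mulCentroid (K j) = mulCentroid (L k) := SetLike.coe_injective (h3.trans h4.symm)
    have h6 : mulCentroid (K 0) = mulCentroid (L k) := SetLike.coe_injective (h1.trans h2.symm)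
    exact ⟨h6.trans h5.symm, h5, h2⟩
  · intro h j k x hx y hy
    -- The condition quantifies over noncentral `a ∈ K 0`; it is not vacuous because `K 0` is
    -- noncentral.
    obtain ⟨a, ha, ha'⟩ := (hK_nc 0).exists_notMem
    obtain ⟨-, h2, h3⟩ := h j k a ha ha'
    apply ofRing_injective
    rw [map_mul, map_mul]
    refine commute_of_mem_centroidLine (a := a) ?_ ?_
    · rw [← h3, ← h2]
      exact ofRing_mem_mulCentroid hx
    · rw [← h3]
      exact ofRing_mem_mulCentroid hy
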